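/- Let $X$ be a complex Banach space and let $Q$ be a bounded linear operator on $X$ that is quasinilpotent, i.e. $\sigma(Q)=\{0\}$. Define the power-bounded set and the Ritt set of $Q$ by $$\mathcal B_Q=\Bigl\{z\in\mathbb C:\ \sup_{j\ge 1}\|(I+zQ)^j\|<\infty\Bigr\},\qquad \mathcal R_Q=\Bigl\{z\in\mathbb C:\ \sup_{\operatorname{Re}s>-1/2}\|(I-szQ)^{-1}\|<\infty\Bigr\},$$ and let $\mathcal B_Q^\circ$ be the interior of $\mathcal B_Q$ in $\mathbb C$. A *sector* is a convex set $A\subset\mathbb C$ such that $rz\in A$ for all $z\in A$ and all $r>0$ (in particular $\mathbb C$ itself is a sector), and for $\theta\in(0,\pi)$ put $\Sigma_\theta=\{re^{it}: r>0,\ t\in(-\theta,\theta)\}$. Then the following hold. (i) $\mathcal R_Q=\mathcal B_Q^\circ\cup\{0\}$; moreover, if $Q\neq 0$, then $\partial\mathcal R_Q=\partial(\mathcal B_Q^\circ)\cup\{0\}$. (ii) $\mathcal R_Q\neq\{0\}$ if and only if $\mathcal B_Q^\circ$ is a non-empty open sector. (iii) Either $\mathcal R_Q=\{0\}$, or $\mathcal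 R_Q=\mathbb C$, or there exist $\phi\in[-\pi,\pi)$ and $\theta\in(0,\pi/2]$ such that $\mathcal R_Q=e^{i\phi}\Sigma_\theta\cup\{0\}$. Furthermore, $\mathcal R_Q=\mathbb C$ if and only if $Q=0$. -/

import Mathlib

open Complex

/-- `Q` is quasinilpotent: its spectrum is exactly `{0}`. -/
def IsQuasinilpotent {X : Type*} [NormedAddCommGroup X] [NormedSpace ℂ X]
    (Q : X →L[ℂ] X) : Prop :=
  spectrum ℂ Q = {0}

/-- The power-bounded set `B_Q`: all `z` such that the powers `(1 + zQ)^j`, `j = 1, 2, …`,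
are bounded in operator norm. -/
def powerBoundedSet {X : Type*} [NormedAddCommGroup X] [NormedSpace ℂ X]
    (Q : X →L[ℂ] X) : Set ℂ :=
  {z | ∃ N : ℝ, ∀ j : ℕ, 1 ≤ j → ‖(1 + z • Q) ^ j‖ ≤ N}

/-- The Ritt set `R_Q`: all `z` such that `(1 - szQ)⁻¹` exists and is bounded in operator norm,
uniformly for `Re s > -1/2`. The existence of the inverse is automatic for quasinilpotent `Q`. -/
def rittSet {X : Type*} [NormedAddCommGroup X] [NormedSpace ℂ X]
    (Q : X →L[ℂ] X) : Set ℂ :=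
  {z | ∃ M : ℝ, ∀ s : ℂ, -(1 / 2 : ℝ) < s.re →
    IsUnit (1 - (s * z) • Q) ∧ ‖Ring.inverse (1 - (s * z) • Q)‖ ≤ M}

/-- A sector: a convex set consisting of full rays, `A ℝ₊ ⊆ A` with `ℝ₊ = (0, ∞)`. -/
def IsSector (A : Set ℂ) : Prop :=
  Convex ℝ A ∧ ∀ z ∈ A, ∀ r : ℝ, 0 < r → z * (r : ℂ) ∈ A

/-- The balanced open sector `Σ_θ = {r e^{it} : r > 0, t ∈ (-θ, θ)}`. -/
def balancedSector (θ : ℝ) : Set ℂ :=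
  {w | ∃ r t : ℝ, 0 < r ∧ t ∈ Set.Ioo (-θ) θ ∧ w = (r : ℂ) * exp ((t : ℂ) * I)}

/-- The rotated open sector `e^{iφ} Σ_θ`. -/
def rotatedSector (φ θ : ℝ) : Set ℂ :=
  (fun w : ℂ => exp ((φ : ℂ) * I) * w) '' balancedSector θ

/-! ### Growth of the resolvent `(1 - w q)⁻¹` on half planes and sectors. -/

section Resolvent

/-! Everything is read off the entire function `w ↦ (1 - wQ)⁻¹`. For `z ≠ 0`, `z` is in the Ritt set
iff this function is bounded on the half plane `H z = {w | 0 ≤ inner ℝ z w}` (`mem_rittSet_iff`): a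
bound on `H z` spreads to a slightly wider sector (`ResolventBoundedOn.sector`), and a compact ball
covers the rest of `Re s > -1/2`.

Geometry of half planes then gives the shape of `rittSet Q \ {0}` for `Q ≠ 0`. It is open because
nearby half planes fit in the wider sector, and convex because `H (x + y) ⊆ H x ∪ H y`. It contains
no opposite points because `H z ∪ H (-z)` is the whole plane, where Liouville forces `Q = 0`.

For the link with powers, a point of the Ritt set is power bounded by a Cauchy estimate for the
squared resolvent (`powerBounded_of_norm_inverse_one_sub_smul_le`). Conversely, power boundedness at
`a` bounds the resolvent on sectors strictly inside `H a` (`resolventBoundedOn_of_powerBounded`);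
two such sectors, for `a` on either side of an interior point `z`, cover `H z`. -/

theorem norm_inverse_one_sub_le_of_pow_le {A : Type*} [NormedRing A]
    {x : A} (hx : IsUnit (1 - x)) {N ρ : ℝ} (hρ0 : 0 ≤ ρ)
    (hρ : ρ < 1) (h : ∀ n : ℕ, ‖x ^ n‖ ≤ N * ρ ^ n) : ‖Ring.inverse (1 - x)‖ ≤ N / (1 - ρ) := by
  have hN : 0 ≤ N := by simpa using (norm_nonneg _).trans (h 0)
  set R := Ring.inverse (1 - x)
  have h1 : ∀ n : ℕ, ‖R‖ ≤ N / (1 - ρ) + N * ρ ^ n * ‖R‖ := by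
    intro n
    -- The truncated Neumann series with its remainder needs no completeness, since the inverse is
    -- already given.
    have h2 : R = ∑ i ∈ Finset.range n, x ^ i + x ^ n * R := by
      have h3 := congrArg (· * R) (geom_sum_mul_neg x n)
      simp only [mul_assoc, sub_mul, one_mul, R, Ring.mul_inverse_cancel _ hx, mul_one] at h3
      rw [h3]
      simp [R]
    have hs : ∑ i ∈ Finset.range n, ρ ^ i ≤ 1 / (1 - ρ) := by
      rw [le_div_iff₀ (by linarith), geom_sum_mul_neg]
      have := pow_nonneg hρ0 n
      linarith
    calc ‖R‖ = ‖∑ i ∈ Finset.range n, x ^ i + x ^ n * R‖ := by rw [← h2]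
      _ ≤ ‖∑ i ∈ Finset.range n, x ^ i‖ + ‖x ^ n * R‖ := norm_add_le _ _
      _ ≤ ∑ i ∈ Finset.range n, N * ρ ^ i + N * ρ ^ n * ‖R‖ := by
          gcongr
          · exact norm_sum_le_of_le _ fun i _ => h i
          · exact (norm_mul_le _ _).trans (by gcongr; exact h n)
      _ ≤ _ := by
          rw [← Finset.mul_sum, div_eq_mul_one_div]
          gcongr
  have h2 : Filter.Tendsto (fun n : ℕ => N / (1 - ρ) + N * ρ ^ n * ‖R‖) Filter.atTop
      (nhds (N / (1 - ρ) + N * 0 * ‖R‖)) :=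
    (((tendsto_pow_atTop_nhds_zero_of_lt_one hρ0 hρ).const_mul N).mul_const ‖R‖).const_add _
  simpa using ge_of_tendsto' h2 h1

variable {A : Type*} [NormedRing A] [NormedAlgebra ℂ A]

/-- The resolvent `w ↦ (1 - w q)⁻¹` is norm bounded on `S`. -/
def ResolventBoundedOn (q : A) (S : Set ℂ) : Prop :=
  ∃ M : ℝ, ∀ w ∈ S, ‖Ring.inverse (1 - w • q)‖ ≤ M

theorem ResolventBoundedOn.mono {q : A} {S T : Set ℂ} (h : ResolventBoundedOn q T) (hST : S ⊆ T) :
    ResolventBoundedOn q S := by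
  obtain ⟨M, hM⟩ := h
  exact ⟨M, fun w hw => hM w (hST hw)⟩

theorem ResolventBoundedOn.union {q : A} {S T : Set ℂ} (hS : ResolventBoundedOn q S)
    (hT : ResolventBoundedOn q T) : ResolventBoundedOn q (S ∪ T) := by
  obtain ⟨M, hM⟩ := hS
  obtain ⟨N, hN⟩ := hT
  refine ⟨max M N, ?_⟩
  rintro w (hw | hw)
  · exact (hM w hw).trans (le_max_left _ _)
  · exact (hN w hw).trans (le_max_right _ _)

theorem isUnit_one_sub_smul_of_spectrum_eq {q : A} (hq : spectrum ℂ q = {0}) (w : ℂ) :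
    IsUnit (1 - w • q) := by
  rcases eq_or_ne w 0 with rfl | hw
  · simp
  · have h : w⁻¹ ∉ spectrum ℂ q := by
      rw [hq]
      simpa using hw
    rw [spectrum.notMem_iff] at h
    have h2 := h.smul (Units.mk0 w hw)
    rwa [smul_sub, Units.smul_def, Units.smul_def, Units.val_mk0, Algebra.algebraMap_eq_smul_one,
      smul_smul, mul_inv_cancel₀ hw, one_smul] at h2

theorem inverse_one_sub_smul_sub {q : A} (hq : ∀ w : ℂ, IsUnit (1 - w • q)) (v w : ℂ) :
    Ring.inverse (1 - w • q) - Ring.inverse (1 - v • q) =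
      (w - v) • (Ring.inverse (1 - w • q) * (q * Ring.inverse (1 - v • q))) := by
  have h1 := Ring.inverse_mul_cancel _ (hq w)
  have h2 := Ring.mul_inverse_cancel _ (hq v)
  set F := Ring.inverse (1 - w • q)
  set G := Ring.inverse (1 - v • q)
  have h3 : F * ((1 - v • q) - (1 - w • q)) * G = F - G := by
    rw [mul_sub, sub_mul, mul_assoc, h2, h1, mul_one, one_mul]
  rw [← h3, show (1 - v • q) - (1 - w • q) = (w - v) • q by rw [sub_smul]; abel]
  simp [mul_assoc]

theorem smul_mul_inverse_one_sub_smul {q : A} (hq : ∀ w : ℂ, IsUnit (1 - w • q)) (w : ℂ) :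
    w • (q * Ring.inverse (1 - w • q)) = Ring.inverse (1 - w • q) - 1 := by
  have h1 := Ring.mul_inverse_cancel _ (hq w)
  rw [sub_mul, one_mul, smul_mul_assoc] at h1
  exact (sub_eq_iff_eq_add.2 (by rw [add_comm, ← sub_eq_iff_eq_add, h1])).symm

/-- Compare `w` just outside the half plane with its orthogonal projection `v` onto the boundary
line. There `v q (1 - v q)⁻¹ = (1 - v q)⁻¹ - 1` is bounded, so `‖q (1 - v q)⁻¹‖` decays like `1 /
‖v‖`, and the resolvent identity tolerates `‖w - v‖` proportional to `‖w‖`. -/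
theorem ResolventBoundedOn.sector {q : A} (hq : ∀ w : ℂ, IsUnit (1 - w • q)) {z : ℂ} (hz : z ≠ 0)
    (h : ResolventBoundedOn q {w | 0 ≤ inner ℝ z w}) :
    ∃ δ > 0, ResolventBoundedOn q {w | -(δ * ‖w‖) ≤ inner ℝ z w} := by
  obtain ⟨M, hM⟩ := h
  have hM0 : 0 ≤ M := (norm_nonneg _).trans (hM 0 (by simp))
  have hz' : 0 < ‖z‖ := norm_pos_iff.2 hz
  -- The extra `1` gives `K ≥ 1`, hence `‖v‖ ≥ ‖w‖ / 2`. The `4` in `δ` then makes the perturbation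
  -- factor at most `1 / 2`, which is absorbed to yield the bound `2 * M`.
  set K := M + ‖(1 : A)‖ + 1 with hK
  have hK1 : 1 ≤ K := by have := norm_nonneg (1 : A); linarith
  refine ⟨‖z‖ / (4 * K), by positivity, 2 * M, fun w hw => ?_⟩
  rcases le_or_gt 0 (inner ℝ z w) with hp | hp
  · exact (hM w hp).trans (by linarith)
  set c : ℝ := inner ℝ z w / ‖z‖ ^ 2 with hc
  set v : ℂ := w - c • z with hv
  have hvz : inner ℝ z v = 0 := by
    rw [hv, inner_sub_right, real_inner_smul_right, real_inner_self_eq_norm_sq, hc]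
    field_simp
    simp
  have hwv : ‖w - v‖ ≤ ‖w‖ / (4 * K) := by
    rw [hv, sub_sub_cancel, norm_smul, hc, Real.norm_eq_abs, abs_div, abs_of_neg hp,
      abs_of_pos (by positivity)]
    have : -inner ℝ z w ≤ ‖z‖ / (4 * K) * ‖w‖ := by
      have : -(‖z‖ / (4 * K) * ‖w‖) ≤ inner ℝ z w := hw
      linarith
    calc -inner ℝ z w / ‖z‖ ^ 2 * ‖z‖ ≤ (‖z‖ / (4 * K) * ‖w‖) / ‖z‖ ^ 2 * ‖z‖ := by gcongr
      _ = ‖w‖ / (4 * K) := by field_simp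
  have hw0 : 0 < ‖w‖ := by
    rw [norm_pos_iff]
    rintro rfl
    simp at hp
  have hvn : ‖w‖ / 2 ≤ ‖v‖ := by
    have h1 : ‖w‖ ≤ ‖w - v‖ + ‖v‖ := by simpa using norm_add_le (w - v) v
    have h2 : ‖w‖ / (4 * K) ≤ ‖w‖ / 2 := by gcongr; linarith
    linarith
  have hG := hM v hvz.ge
  have h1 : ‖v‖ * ‖q * Ring.inverse (1 - v • q)‖ ≤ K := by
    rw [← norm_smul, smul_mul_inverse_one_sub_smul hq]
    exact (norm_sub_le _ _).trans (by linarith)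
  have h2 : ‖w - v‖ * ‖q * Ring.inverse (1 - v • q)‖ ≤ 1 / 2 := by
    calc ‖w - v‖ * ‖q * Ring.inverse (1 - v • q)‖
        ≤ (‖v‖ / (2 * K)) * ‖q * Ring.inverse (1 - v • q)‖ := by
          gcongr
          refine hwv.trans ?_
          calc ‖w‖ / (4 * K) = ‖w‖ / 2 / (2 * K) := by field_simp; norm_num
            _ ≤ _ := by gcongr
      _ = (‖v‖ * ‖q * Ring.inverse (1 - v • q)‖) / (2 * K) := by ring
      _ ≤ K / (2 * K) := by gcongr
      _ = 1 / 2 := by field_simp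
  have h3 : ‖Ring.inverse (1 - w • q) - Ring.inverse (1 - v • q)‖ ≤
      ‖Ring.inverse (1 - w • q)‖ * (1 / 2) := by
    rw [inverse_one_sub_smul_sub hq, norm_smul]
    calc _ ≤ ‖w - v‖ * (‖Ring.inverse (1 - w • q)‖ * ‖q * Ring.inverse (1 - v • q)‖) := by
          gcongr; exact norm_mul_le _ _
      _ = ‖Ring.inverse (1 - w • q)‖ * (‖w - v‖ * ‖q * Ring.inverse (1 - v • q)‖) := by ring
      _ ≤ _ := by gcongr
  have h4 : ‖Ring.inverse (1 - w • q)‖ ≤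
      ‖Ring.inverse (1 - w • q) - Ring.inverse (1 - v • q)‖ + ‖Ring.inverse (1 - v • q)‖ := by
    simpa using norm_add_le (Ring.inverse (1 - w • q) - Ring.inverse (1 - v • q))
      (Ring.inverse (1 - v • q))
  linarith

/-- With `μ = a / w` and `l = 1 + μ`, the resolvent is `μ / l` times `(1 - l⁻¹ (1 + a q))⁻¹`, so its
norm is at most a constant times `‖μ‖ / (‖l‖ - 1)`. This stays bounded because `μ` lies in a sector
strictly inside the right half plane, where `‖1 + μ‖ ≥ 1 + k ‖μ‖`. -/
theorem resolventBoundedOn_of_powerBounded {q : A} (hq : ∀ w : ℂ, IsUnit (1 - w • q)) {a : ℂ}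
    {N : ℝ} (hN : ∀ j : ℕ, 1 ≤ j → ‖(1 + a • q) ^ j‖ ≤ N) {c : ℝ} (hc : 0 < c) :
    ResolventBoundedOn q {w | c * ‖w‖ ≤ inner ℝ a w} := by
  set N' := max N ‖(1 : A)‖
  have hN' : ∀ j : ℕ, ‖(1 + a • q) ^ j‖ ≤ N' := by
    intro j
    rcases j with _ | j
    · simp [N']
    · exact (hN _ (by omega)).trans (le_max_left _ _)
  have hN0 : 0 ≤ N' := (norm_nonneg _).trans (le_max_right _ _)
  refine ⟨max (N' * (‖a‖ / c)) ‖(1 : A)‖, fun w hw => ?_⟩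
  rcases eq_or_ne w 0 with rfl | hw0
  · simp
  refine le_trans ?_ (le_max_left _ _)
  have hw' : 0 < ‖w‖ := norm_pos_iff.2 hw0
  have hin : c * ‖w‖ ≤ inner ℝ a w := hw
  have ha0 : a ≠ 0 := by
    rintro rfl
    rw [inner_zero_left] at hin
    nlinarith
  have ha' : 0 < ‖a‖ := norm_pos_iff.2 ha0
  have hca : c ≤ ‖a‖ := by
    have := hin.trans (real_inner_le_norm a w)
    exact le_of_mul_le_mul_right this hw'
  set μ := a / w with hμ
  have hμ0 : μ ≠ 0 := div_ne_zero ha0 hw0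
  set k := c / ‖a‖ with hk
  have hk0 : 0 < k := by positivity
  have hk1 : k ≤ 1 := (div_le_one ha').2 hca
  have hre : k * ‖μ‖ ≤ μ.re := by
    have h1 : μ.re = inner ℝ a w / ‖w‖ ^ 2 := by
      rw [hμ, Complex.div_re, Complex.inner, ← Complex.normSq_eq_norm_sq]
      simp
      ring
    rw [h1, hμ, hk, norm_div, le_div_iff₀ (by positivity)]
    calc c / ‖a‖ * (‖a‖ / ‖w‖) * ‖w‖ ^ 2 = c * ‖w‖ := by field_simp
      _ ≤ _ := hin
  have hμ' : 0 < ‖μ‖ := norm_pos_iff.2 hμ0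
  have hl : 1 + k * ‖μ‖ ≤ ‖1 + μ‖ := by
    refine le_of_pow_le_pow_left₀ two_ne_zero (norm_nonneg _) ?_
    rw [← Complex.normSq_eq_norm_sq, Complex.normSq_add]
    have h1 : Complex.normSq μ = ‖μ‖ ^ 2 := Complex.normSq_eq_norm_sq μ
    simp only [map_one, h1, one_mul, Complex.conj_re]
    have : (k * ‖μ‖) ^ 2 ≤ ‖μ‖ ^ 2 := by
      rw [mul_pow]
      have : k ^ 2 ≤ 1 := pow_le_one₀ hk0.le hk1
      nlinarith [sq_nonneg ‖μ‖]
    nlinarith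
  set l := 1 + μ
  have hkμ : 0 < k * ‖μ‖ := by positivity
  have hl0 : l ≠ 0 := by
    rw [← norm_pos_iff]
    linarith
  have hx : 1 - w • q = (l / μ) • (1 - l⁻¹ • (1 + a • q)) := by
    rw [smul_sub, smul_smul, smul_add, smul_smul]
    have e1 : l / μ * l⁻¹ = μ⁻¹ := by field_simp
    have e2 : μ⁻¹ * a = w := by rw [hμ]; field_simp
    have e3 : l / μ = 1 + μ⁻¹ := by simp only [l]; field_simp; ring
    rw [e1, e2, e3, add_smul, one_smul]
    abel
  have hlμ : l / μ ≠ 0 := div_ne_zero hl0 hμ0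
  have hu : IsUnit (1 - l⁻¹ • (1 + a • q)) := by
    have := (hq w).smul (Units.mk0 _ hlμ)⁻¹
    rwa [hx, Units.smul_def, smul_smul, Units.val_inv_eq_inv_val, Units.val_mk0,
      inv_mul_cancel₀ hlμ, one_smul] at this
  have hinv : Ring.inverse (1 - w • q) =
      (μ / l) • Ring.inverse (1 - l⁻¹ • (1 + a • q)) := by
    refine (hq w).mul_left_cancel ?_
    rw [Ring.mul_inverse_cancel _ (hq w), hx, smul_mul_smul_comm, Ring.mul_inverse_cancel _ hu,
      div_mul_div_cancel₀ hμ0, div_self hl0, one_smul]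
  have hb := norm_inverse_one_sub_le_of_pow_le hu (N := N') (ρ := ‖l‖⁻¹) (by positivity)
    (inv_lt_one_of_one_lt₀ (by linarith)) (fun n => by
      rw [smul_pow, norm_smul, norm_pow, norm_inv, mul_comm]
      gcongr
      exact hN' n)
  have hl1 : 0 < ‖l‖ := by linarith
  rw [hinv, norm_smul, norm_div]
  calc ‖μ‖ / ‖l‖ * ‖Ring.inverse (1 - l⁻¹ • (1 + a • q))‖
      ≤ ‖μ‖ / ‖l‖ * (N' / (1 - ‖l‖⁻¹)) := by gcongr
    _ = N' * (‖μ‖ / (‖l‖ - 1)) := by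
        have : ‖l‖ - 1 ≠ 0 := by linarith
        field_simp
    _ ≤ N' * (‖μ‖ / (k * ‖μ‖)) := by gcongr; linarith
    _ = N' * (‖a‖ / c) := by rw [hk]; field_simp

variable [CompleteSpace A]

theorem differentiable_inverse_one_sub_smul {q : A} (hq : ∀ w : ℂ, IsUnit (1 - w • q)) :
    Differentiable ℂ fun w : ℂ => Ring.inverse (1 - w • q) := by
  intro w
  exact (differentiableAt_inverse (hq w)).comp w (f := fun w : ℂ => 1 - w • q) (by fun_prop)

theorem eq_zero_of_resolventBoundedOn_univ {q : A} (hq : ∀ w : ℂ, IsUnit (1 - w • q))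
    (h : ResolventBoundedOn q Set.univ) : q = 0 := by
  obtain ⟨M, hM⟩ := h
  have hb : Bornology.IsBounded (Set.range fun w : ℂ => Ring.inverse (1 - w • q)) := by
    refine isBounded_iff_forall_norm_le.2 ⟨M, ?_⟩
    rintro _ ⟨w, rfl⟩
    exact hM w trivial
  have h1 : Ring.inverse (1 - (1 : ℂ) • q) = Ring.inverse (1 - (0 : ℂ) • q) :=
    (differentiable_inverse_one_sub_smul hq).apply_eq_apply_of_bounded hb 1 0
  have h2 := smul_mul_inverse_one_sub_smul hq 1
  rw [h1, zero_smul, sub_zero, Ring.inverse_one, mul_one, one_smul, sub_self] at h2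
  exact h2

theorem resolventBoundedOn_closedBall {q : A} (hq : ∀ w : ℂ, IsUnit (1 - w • q)) (R : ℝ) :
    ResolventBoundedOn q (Metric.closedBall 0 R) := by
  obtain ⟨M, hM⟩ := (isCompact_closedBall (0 : ℂ) R).exists_bound_of_continuousOn
    (differentiable_inverse_one_sub_smul hq).continuous.continuousOn
  exact ⟨M, hM⟩

/-- Boundedness of the resolvent on a half plane through the origin is equivalent to boundedness
on a strictly larger half plane. -/
theorem resolventBoundedOn_halfPlane_iff {q : A} (hq : ∀ w : ℂ, IsUnit (1 - w • q)) {z : ℂ}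
    (hz : z ≠ 0) :
    ResolventBoundedOn q {w | 0 ≤ inner ℝ z w} ↔
      ∃ M : ℝ, ∀ s : ℂ, -(1 / 2 : ℝ) < s.re → ‖Ring.inverse (1 - (s * z) • q)‖ ≤ M := by
  have hz' : 0 < ‖z‖ := norm_pos_iff.2 hz
  have key : ∀ s : ℂ, inner ℝ z (s * z) = s.re * ‖z‖ ^ 2 := by
    intro s
    rw [Complex.inner, ← Complex.normSq_eq_norm_sq, Complex.normSq_apply]
    simp
    ring
  constructor
  · intro h
    obtain ⟨δ, hδ, h⟩ := h.sector hq hz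
    -- Outside this ball `δ * ‖s * z‖` exceeds `‖z‖ ^ 2 / 2`, the most by which `inner ℝ z (s * z)`
    -- can be negative.
    obtain ⟨M, hM⟩ := h.union (resolventBoundedOn_closedBall hq (‖z‖ ^ 2 / (2 * δ)))
    refine ⟨M, fun s hs => hM _ ?_⟩
    rcases le_or_gt ‖s * z‖ (‖z‖ ^ 2 / (2 * δ)) with h1 | h1
    · exact Or.inr (by simpa using h1)
    · left
      simp only [Set.mem_ofPred_eq, key]
      rw [div_lt_iff₀ (by positivity)] at h1
      nlinarith [sq_pos_of_pos hz']
  · rintro ⟨M, hM⟩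
    refine ⟨M, fun w hw => ?_⟩
    have h1 := key (w / z)
    rw [div_mul_cancel₀ _ hz] at h1
    have h2 : -(1 / 2 : ℝ) < (w / z).re := by
      have : 0 ≤ (w / z).re * ‖z‖ ^ 2 := h1 ▸ hw
      have := nonneg_of_mul_nonneg_left this (by positivity)
      linarith
    simpa [div_mul_cancel₀ _ hz] using hM _ h2

end Resolvent

/-! ### From a resolvent bound in the unit disc to bounded powers. -/

section PowerBounded

theorem circleIntegrable_inv_norm_one_sub_sq {r : ℝ} (hr0 : 0 < r) (hr1 : r < 1) :
    CircleIntegrable (fun z : ℂ => (‖1 - z‖ ^ 2)⁻¹) 0 r := by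
  refine ContinuousOn.circleIntegrable hr0.le (ContinuousOn.inv₀ (by fun_prop) fun z hz => ?_)
  rw [mem_sphere_zero_iff_norm] at hz
  refine pow_ne_zero _ (norm_ne_zero_iff.2 (sub_ne_zero.2 ?_))
  rintro rfl
  simp at hz
  linarith

/-- On `‖z‖ = r` one has `‖z - r ^ 2‖ = r * ‖1 - z‖`, so `(1 - r ^ 2) / ‖1 - z‖ ^ 2` is the Poisson
kernel at the point `r ^ 2`, whose mean is `1`. -/
theorem circleAverage_inv_norm_one_sub_sq {r : ℝ} (hr0 : 0 < r) (hr1 : r < 1) :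
    Real.circleAverage (fun z : ℂ => (‖1 - z‖ ^ 2)⁻¹) 0 r = (1 - r ^ 2)⁻¹ := by
  have hw : ((r : ℂ) ^ 2) ∈ Metric.ball (0 : ℂ) r := by
    rw [mem_ball_zero_iff, norm_pow, Complex.norm_real, Real.norm_of_nonneg hr0.le]
    nlinarith
  have h := DiffContOnCl.circleAverage_poissonKernel_smul (f := fun _ : ℂ => (1 : ℂ)) (c := 0)
    diffContOnCl_const hw
  have h2 : Real.circleAverage
      (Complex.ofRealCLM ∘ fun z : ℂ => (1 - r ^ 2) • (‖1 - z‖ ^ 2)⁻¹) 0 r = 1 := by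
    refine Eq.trans ?_ h
    refine Real.circleAverage_congr_sphere fun z hz => ?_
    rw [abs_of_pos hr0, mem_sphere_zero_iff_norm] at hz
    have hzz : z * (starRingEnd ℂ) z = (r : ℂ) ^ 2 := by
      rw [Complex.mul_conj, Complex.normSq_eq_norm_sq, hz]
      norm_cast
    have h3 : ‖z - (r : ℂ) ^ 2‖ = r * ‖1 - z‖ := by
      rw [← hzz, ← hz, show z - z * (starRingEnd ℂ) z = z * (starRingEnd ℂ) (1 - z) by
        simp; ring, norm_mul, RCLike.norm_conj]
    rw [Pi.smul_apply', poissonKernel_def]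
    simp only [Function.comp_apply, Complex.ofRealCLM_apply, sub_zero, hz, h3, norm_pow,
      Complex.norm_real, Real.norm_of_nonneg hr0.le, Complex.real_smul, mul_one, smul_eq_mul]
    congr 1
    have : ‖1 - z‖ ≠ 0 := by
      rw [norm_ne_zero_iff, sub_ne_zero]
      rintro rfl
      simp at hz
      linarith
    field_simp
  rw [Complex.ofRealCLM.circleAverage_comp_comm
    (f := fun z : ℂ => (1 - r ^ 2) • (‖1 - z‖ ^ 2)⁻¹)
    (circleIntegrable_inv_norm_one_sub_sq hr0 hr1).const_smul, Real.circleAverage_fun_smul,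
    Complex.ofRealCLM_apply, Complex.ofReal_eq_one, smul_eq_mul] at h2
  exact eq_inv_of_mul_eq_one_right h2

variable {A : Type*} [NormedRing A] [NormedAlgebra ℂ A] [CompleteSpace A]

theorem hasFPowerSeriesAt_inverse_one_sub_smul_sq (T : A) :
    HasFPowerSeriesAt (fun u : ℂ => Ring.inverse (1 - u • T) ^ 2)
      ((fun n => ContinuousMultilinearMap.mkPiRing ℂ (Fin n) (((n + 1 : ℕ) : ℂ) • T ^ n)) :
        FormalMultilinearSeries ℂ ℂ A) 0 := by
  refine hasFPowerSeriesAt_iff.2 ?_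
  have h1 : ∀ᶠ u : ℂ in nhds 0, ‖u • T‖ < 1 := by
    have : ContinuousAt (fun u : ℂ => ‖u • T‖) 0 := by fun_prop
    exact this.eventually_lt_const (by simp)
  filter_upwards [h1] with u hu
  have h2 := hasSum_choose_mul_geometric_of_norm_lt_one' 1 hu
  rw [zero_add]
  have h3 : (fun n : ℕ => (((n + 1).choose 1 : ℕ) : A) * (u • T) ^ n) =
      fun n => u ^ n • (((n + 1 : ℕ) : ℂ) • T ^ n) := by
    funext n
    rw [Nat.choose_one_right, smul_pow, mul_smul_comm, Nat.cast_smul_eq_nsmul, nsmul_eq_mul]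
  rw [h3] at h2
  simpa [FormalMultilinearSeries.coeff] using h2

/-- Cauchy's estimate for the resolvent itself would lose a logarithm. Its square has coefficients
`(n + 1) T ^ n`, and the mean of `M ^ 2 / ‖1 - u‖ ^ 2` is of order `n + 1` at radius `n / (n + 1)`,
so the factors cancel. -/
theorem powerBounded_of_norm_inverse_one_sub_smul_le {T : A} {M : ℝ}
    (hT : ∀ u : ℂ, ‖u‖ < 1 → IsUnit (1 - u • T))
    (hM : ∀ u : ℂ, ‖u‖ < 1 → ‖Ring.inverse (1 - u • T)‖ ≤ M / ‖1 - u‖) :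
    ∃ N : ℝ, ∀ n : ℕ, 1 ≤ n → ‖T ^ n‖ ≤ N := by
  refine ⟨Real.exp 1 * M ^ 2, fun n hn => ?_⟩
  have hn' : (0 : ℝ) < n := by exact_mod_cast hn
  set r : ℝ := n / (n + 1) with hr
  have hr0 : 0 < r := by positivity
  have hr1 : r < 1 := by rw [hr, div_lt_one (by positivity)]; linarith
  set f : ℂ → A := fun u => Ring.inverse (1 - u • T) ^ 2 with hf
  have hdiff : DifferentiableOn ℂ f (Metric.closedBall 0 r) := by
    intro u hu
    have hu' : ‖u‖ < 1 := lt_of_le_of_lt (by simpa using hu) hr1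
    have h1 : DifferentiableAt ℂ (fun u : ℂ => Ring.inverse (1 - u • T)) u :=
      (differentiableAt_inverse (hT u hu')).comp u (f := fun u : ℂ => 1 - u • T) (by fun_prop)
    exact (h1.fun_pow 2).differentiableWithinAt
  have hps : HasFPowerSeriesOnBall f (cauchyPowerSeries f 0 r) 0 (ENNReal.ofReal r) := by
    have := DifferentiableOn.hasFPowerSeriesOnBall (R := .mk r hr0.le) hdiff hr0
    rwa [ENNReal.ofReal, Real.toNNReal_of_nonneg hr0.le]
  have heq := hps.hasFPowerSeriesAt.eq_formalMultilinearSeries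
    (hasFPowerSeriesAt_inverse_one_sub_smul_sq T)
  have hle := norm_cauchyPowerSeries_le f 0 r n
  rw [heq, ContinuousMultilinearMap.norm_mkPiRing] at hle
  have hint : (2 * Real.pi)⁻¹ * ∫ θ in (0)..(2 * Real.pi), ‖f (circleMap 0 r θ)‖ ≤
      M ^ 2 * (1 - r ^ 2)⁻¹ := by
    have h1 := Real.circleAverage_mono (f₁ := fun u => ‖f u‖) (f₂ := fun z => M ^ 2 • (‖1 - z‖ ^ 2)⁻¹)
      (c := 0) (R := r) (by
        refine ContinuousOn.circleIntegrable hr0.le (ContinuousOn.norm ?_)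
        exact hdiff.continuousOn.mono Metric.sphere_subset_closedBall)
      ((circleIntegrable_inv_norm_one_sub_sq hr0 hr1).const_smul) (fun u hu => by
        rw [abs_of_pos hr0, mem_sphere_zero_iff_norm] at hu
        have h2 := hM u (by linarith)
        calc ‖f u‖ ≤ ‖Ring.inverse (1 - u • T)‖ ^ 2 := norm_pow_le' _ two_pos
          _ ≤ (M / ‖1 - u‖) ^ 2 := by gcongr
          _ = _ := by rw [div_pow, smul_eq_mul, div_eq_mul_inv])
    rw [Real.circleAverage_fun_smul, circleAverage_inv_norm_one_sub_sq hr0 hr1] at h1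
    simpa [Real.circleAverage_def] using h1
  have hexp : r⁻¹ ^ n ≤ Real.exp 1 := by
    have h1 : r⁻¹ ≤ Real.exp (1 / n) := by
      have := Real.add_one_le_exp (1 / (n : ℝ))
      rw [hr, inv_div, add_div, div_self hn'.ne']
      linarith
    calc r⁻¹ ^ n ≤ Real.exp (1 / n) ^ n := by gcongr
      _ = Real.exp 1 := by rw [← Real.exp_nat_mul]; congr 1; field_simp
  have hr2 : (1 - r ^ 2)⁻¹ ≤ (n : ℝ) + 1 := by
    have h1 : 1 - r = 1 / (n + 1) := by rw [hr]; field_simp; ring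
    have h2 : 1 / ((n : ℝ) + 1) ≤ 1 - r ^ 2 := by nlinarith
    calc (1 - r ^ 2)⁻¹ ≤ (1 / ((n : ℝ) + 1))⁻¹ := by gcongr
      _ = _ := by simp
  have hfin : (n + 1 : ℝ) * ‖T ^ n‖ ≤ (n + 1) * (Real.exp 1 * M ^ 2) := by
    calc (n + 1 : ℝ) * ‖T ^ n‖ = ‖((n + 1 : ℕ) : ℂ) • T ^ n‖ := by
          rw [norm_smul, Complex.norm_natCast]; push_cast; rfl
      _ ≤ _ := hle
      _ ≤ (M ^ 2 * (1 - r ^ 2)⁻¹) * |r|⁻¹ ^ n := by gcongr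
      _ = M ^ 2 * (1 - r ^ 2)⁻¹ * r⁻¹ ^ n := by rw [abs_of_pos hr0]
      _ ≤ M ^ 2 * (n + 1) * Real.exp 1 := by gcongr
      _ = _ := by ring
  exact le_of_mul_le_mul_left hfin (by positivity)

end PowerBounded

/-! ### Planar geometry of open sectors without opposite points. -/

section Sector

theorem exists_eq_Ioo_of_isOpen_of_isPreconnected {D : Set ℝ} (ho : IsOpen D)
    (hc : IsPreconnected D) (hne : D.Nonempty) (hb : BddBelow D) (ha : BddAbove D) :
    ∃ a b : ℝ, a < b ∧ D = Set.Ioo a b := by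
  have h : D = Set.Ioo (sInf D) (sSup D) := by
    refine Set.Subset.antisymm ?_ (IsConnected.Ioo_csInf_csSup_subset ⟨hne, hc⟩ hb ha)
    rw [← interior_Icc]
    exact interior_maximal (fun x hx => ⟨csInf_le hb hx, le_csSup ha hx⟩) ho
  refine ⟨_, _, ?_, h⟩
  rw [h] at hne
  exact Set.nonempty_Ioo.1 hne

/-- A nonempty open sector containing no pair of opposite points is a rotated open sector of
half-angle at most `π / 2`. -/
theorem IsSector.exists_eq_rotatedSector {C : Set ℂ} (hC : IsSector C) (ho : IsOpen C)
    (hne : C.Nonempty) (hopp : ∀ z ∈ C, -z ∉ C) :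
    ∃ φ ∈ Set.Ico (-Real.pi) Real.pi, ∃ θ ∈ Set.Ioc (0 : ℝ) (Real.pi / 2),
      C = rotatedSector φ θ := by
  obtain ⟨hconv, hcone⟩ := hC
  obtain ⟨z₀, hz₀⟩ := hne
  have h0 : (0 : ℂ) ∉ C := fun h => hopp 0 h (by simpa using h)
  have hz₀0 : z₀ ≠ 0 := fun h => h0 (h ▸ hz₀)
  have hz₀' : 0 < ‖z₀‖ := norm_pos_iff.2 hz₀0
  -- Rotated so that `1` belongs to the sector, it misses the negative real axis, where `arg` jumps;
  -- its set of arguments is then an open interval.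
  set C' : Set ℂ := (fun w => z₀ * w) ⁻¹' C with hC'
  have hcone' : ∀ w ∈ C', ∀ r : ℝ, 0 < r → (r : ℂ) * w ∈ C' := by
    intro w hw r hr
    have := hcone _ hw r hr
    rw [hC', Set.mem_preimage]
    convert this using 1
    ring
  have hpolar : ∀ w : ℂ, w ∈ C' → exp (arg w * I) ∈ C' := by
    intro w hw
    have hw0 : w ≠ 0 := by
      rintro rfl
      exact h0 (by simpa [hC'] using hw)
    have hw' : 0 < ‖w‖ := norm_pos_iff.2 hw0
    have := hcone' w hw ‖w‖⁻¹ (by positivity)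
    rw [← norm_mul_exp_arg_mul_I w, ← mul_assoc, ← ofReal_mul] at this
    simpa [hw0] using this
  have hslit : C' ⊆ slitPlane := by
    intro w hw
    rw [mem_slitPlane_iff_arg]
    refine ⟨fun h => ?_, ?_⟩
    · have h1 := hpolar w hw
      rw [h, exp_pi_mul_I] at h1
      exact hopp z₀ hz₀ (by simpa [hC'] using h1)
    · rintro rfl
      exact h0 (by simpa [hC'] using hw)
  set D : Set ℝ := arg '' C' with hD
  have hDmem : ∀ t : ℝ, t ∈ D ↔ t ∈ Set.Ioo (-Real.pi) Real.pi ∧ exp (t * I) ∈ C' := by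
    intro t
    constructor
    · rintro ⟨w, hw, rfl⟩
      exact ⟨⟨neg_pi_lt_arg w, lt_of_le_of_ne (arg_le_pi w) (mem_slitPlane_iff_arg.1 (hslit hw)).1⟩,
        hpolar w hw⟩
    · rintro ⟨ht, h⟩
      exact ⟨_, h, by rw [arg_exp_mul_I, toIocMod_eq_self]; constructor <;> linarith [ht.1, ht.2]⟩
  have hDo : IsOpen D := by
    have h1 : D = Set.Ioo (-Real.pi) Real.pi ∩ (fun t : ℝ => exp (t * I)) ⁻¹' C' := Set.ext hDmem
    rw [h1]
    exact isOpen_Ioo.inter ((ho.preimage (by fun_prop)).preimage (by fun_prop))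
  have hDc : IsPreconnected D := by
    have h1 : Convex ℝ C' := hconv.linear_preimage (LinearMap.mulLeft ℝ z₀)
    exact h1.isPreconnected.image _ fun w hw => (continuousAt_arg (hslit hw)).continuousWithinAt
  have hDne : D.Nonempty := ⟨arg 1, 1, by simpa [hC'] using hz₀, rfl⟩
  obtain ⟨a, b, hab, hDab⟩ := exists_eq_Ioo_of_isOpen_of_isPreconnected hDo hDc hDne
    ⟨-Real.pi, fun t ht => ((hDmem t).1 ht).1.1.le⟩ ⟨Real.pi, fun t ht => ((hDmem t).1 ht).1.2.le⟩
  -- A longer interval would contain two angles differing by `π`, hence opposite points.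
  have hlen : b - a ≤ Real.pi := by
    by_contra! h
    have h1 : (a + b) / 2 - Real.pi / 2 ∈ D := by
      rw [hDab]; constructor <;> linarith [Real.pi_pos]
    have h2 : (a + b) / 2 + Real.pi / 2 ∈ D := by
      rw [hDab]; constructor <;> linarith [Real.pi_pos]
    have h3 := ((hDmem _).1 h1).2
    have h4 := ((hDmem _).1 h2).2
    have h5 : exp (((a + b) / 2 + Real.pi / 2 : ℝ) * I) =
        -exp (((a + b) / 2 - Real.pi / 2 : ℝ) * I) := by
      rw [← neg_one_mul, ← exp_pi_mul_I, ← exp_add]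
      congr 1
      push_cast
      ring
    rw [h5] at h4
    exact hopp _ h3 (by simpa [hC'] using h4)
  set ψ := arg z₀ + (a + b) / 2 with hψ
  set φ := toIcoMod Real.two_pi_pos (-Real.pi) ψ with hφ
  have hexp : exp (φ * I) = exp (ψ * I) := by
    have h1 := toIcoMod_add_toIcoDiv_zsmul Real.two_pi_pos (-Real.pi) ψ
    rw [← hφ] at h1
    refine exp_eq_exp_iff_exists_int.2 ⟨-toIcoDiv Real.two_pi_pos (-Real.pi) ψ, ?_⟩
    rw [zsmul_eq_mul, ← eq_sub_iff_add_eq] at h1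
    rw [h1]
    push_cast
    ring
  have hφm : φ ∈ Set.Ico (-Real.pi) Real.pi := by
    have := toIcoMod_mem_Ico Real.two_pi_pos (-Real.pi) ψ
    rwa [show -Real.pi + 2 * Real.pi = Real.pi by ring] at this
  refine ⟨φ, hφm, (b - a) / 2, ⟨by linarith, by linarith⟩, ?_⟩
  have hprod : ∀ t : ℝ, z₀ * exp (((a + b) / 2 + t : ℝ) * I) =
      ‖z₀‖ * (exp (φ * I) * exp (t * I)) := by
    intro t
    conv_lhs => rw [← norm_mul_exp_arg_mul_I z₀]
    rw [hexp, mul_assoc, ← exp_add, ← exp_add, hψ]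
    congr 2
    push_cast
    ring
  ext z
  constructor
  · intro hz
    have hw : z / z₀ ∈ C' := by
      rw [hC', Set.mem_preimage]
      simpa [mul_div_cancel₀ _ hz₀0] using hz
    have hD1 : arg (z / z₀) ∈ Set.Ioo a b := hDab ▸ ⟨_, hw, rfl⟩
    have hz0 : z ≠ 0 := fun h => h0 (h ▸ hz)
    refine ⟨_, ⟨‖z‖, arg (z / z₀) - (a + b) / 2, norm_pos_iff.2 hz0,
      ⟨by linarith [hD1.1], by linarith [hD1.2]⟩, rfl⟩, ?_⟩
    have h1 := hprod (arg (z / z₀) - (a + b) / 2)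
    rw [add_sub_cancel] at h1
    have h2 : z = ‖z‖ / ‖z₀‖ * (z₀ * exp (arg (z / z₀) * I)) := by
      have h3 : z₀ * (z / z₀) = z := mul_div_cancel₀ _ hz₀0
      conv_lhs => rw [← h3, ← norm_mul_exp_arg_mul_I (z / z₀), norm_div]
      push_cast
      ring
    rw [h1] at h2
    conv_rhs => rw [h2]
    have : (‖z₀‖ : ℂ) ≠ 0 := by exact_mod_cast hz₀'.ne'
    field_simp
  · rintro ⟨_, ⟨r, t, hr, ht, rfl⟩, rfl⟩
    have hD1 : (a + b) / 2 + t ∈ D := by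
      rw [hDab]
      constructor <;> linarith [ht.1, ht.2]
    have h1 := hcone' _ ((hDmem _).1 hD1).2 (r / ‖z₀‖) (by positivity)
    rw [hC', Set.mem_preimage, mul_left_comm, hprod] at h1
    convert h1 using 1
    have : (‖z₀‖ : ℂ) ≠ 0 := by exact_mod_cast hz₀'.ne'
    push_cast
    field_simp

theorem frontier_union_zero {C : Set ℂ} (ho : IsOpen C)
    (hopp : ∀ z ∈ C, -z ∉ C) : frontier (C ∪ {0}) = frontier C ∪ {0} := by
  have h0 : (0 : ℂ) ∉ C := fun h => hopp 0 h (by simpa using h)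
  have hint : interior (C ∪ {0}) = C := by
    refine Set.Subset.antisymm (fun z hz => ?_) (interior_maximal Set.subset_union_left ho)
    rcases interior_subset hz with h | rfl
    · exact h
    exfalso
    obtain ⟨ε, hε, h⟩ := Metric.mem_nhds_iff.1 (mem_interior_iff_mem_nhds.1 hz)
    have hε0 : ((ε / 2 : ℝ) : ℂ) ≠ 0 := by
      rw [Ne, ofReal_eq_zero]
      linarith
    have hmem : ∀ w : ℂ, ‖w‖ = ε / 2 → w ∈ C := by
      intro w hw
      refine (h (by rw [mem_ball_zero_iff, hw]; linarith)).resolve_right ?_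
      rintro rfl
      rw [norm_zero] at hw
      linarith
    have hn : ‖((ε / 2 : ℝ) : ℂ)‖ = ε / 2 := by
      rw [norm_real, Real.norm_of_nonneg (by linarith)]
    exact hopp _ (hmem _ hn) (hmem _ (by rw [norm_neg, hn]))
  rw [frontier, hint, ho.frontier_eq, closure_union, closure_singleton, Set.union_sdiff_distrib]
  congr 1
  exact sdiff_eq_left.2 (Set.disjoint_singleton_left.2 h0)

end Sector

/-! ### The Ritt set and its comparison with the power-bounded set. -/

section RittSet

variable {X : Type*} [NormedAddCommGroup X] [NormedSpace ℂ X]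

theorem zero_mem_rittSet (Q : X →L[ℂ] X) : (0 : ℂ) ∈ rittSet Q :=
  ⟨‖(1 : X →L[ℂ] X)‖, fun s _ => by simp⟩

theorem rittSet_zero : rittSet (0 : X →L[ℂ] X) = Set.univ :=
  Set.eq_univ_of_forall fun z => ⟨‖(1 : X →L[ℂ] X)‖, fun s _ => by simp⟩

theorem powerBoundedSet_zero : powerBoundedSet (0 : X →L[ℂ] X) = Set.univ :=
  Set.eq_univ_of_forall fun z => ⟨‖(1 : X →L[ℂ] X)‖, fun j _ => by simp⟩

variable [CompleteSpace X] {Q : X →L[ℂ] X}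

theorem mem_rittSet_iff (hQ : IsQuasinilpotent Q) {z : ℂ} (hz : z ≠ 0) :
    z ∈ rittSet Q ↔ ResolventBoundedOn Q {w | 0 ≤ inner ℝ z w} := by
  have hu := isUnit_one_sub_smul_of_spectrum_eq hQ
  rw [resolventBoundedOn_halfPlane_iff hu hz]
  exact exists_congr fun M => forall₂_congr fun s _ => and_iff_right (hu _)

theorem neg_notMem_rittSet (hQ : IsQuasinilpotent Q) (hQ0 : Q ≠ 0) {z : ℂ} (hz : z ≠ 0)
    (h : z ∈ rittSet Q) : -z ∉ rittSet Q := by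
  intro h'
  rw [mem_rittSet_iff hQ hz] at h
  rw [mem_rittSet_iff hQ (neg_ne_zero.2 hz)] at h'
  refine hQ0 (eq_zero_of_resolventBoundedOn_univ (isUnit_one_sub_smul_of_spectrum_eq hQ)
    ((h.union h').mono fun w _ => ?_))
  rcases le_total 0 (inner ℝ z w) with hw | hw
  · exact Or.inl hw
  · right
    change 0 ≤ inner ℝ (-z) w
    rwa [inner_neg_left, neg_nonneg]

/-- The Möbius map `u ↦ u / (1 - u)` sends the unit disc into `Re s > -1/2`, the origin of the
constant `-1/2`, and turns the Ritt bound into `M / ‖1 - u‖` for `1 + z • Q`. -/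
theorem rittSet_subset_powerBoundedSet (Q : X →L[ℂ] X) : rittSet Q ⊆ powerBoundedSet Q := by
  rintro z ⟨M, hM⟩
  have hfac : ∀ u : ℂ, ‖u‖ < 1 →
      u ≠ 1 ∧ 1 - u • (1 + z • Q) = (1 - u) • (1 - (u / (1 - u) * z) • Q) ∧
        -(1 / 2 : ℝ) < (u / (1 - u)).re := by
    intro u hu
    have hu1 : u ≠ 1 := by
      rintro rfl
      simp at hu
    have h1 : 1 - u ≠ 0 := sub_ne_zero.2 hu1.symm
    refine ⟨hu1, ?_, ?_⟩
    · rw [smul_sub, smul_smul, ← mul_assoc, mul_div_cancel₀ _ h1, sub_smul, smul_add, smul_smul,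
        one_smul]
      abel
    · have h2 : u / (1 - u) + 1 / 2 = (1 + u) / (2 * (1 - u)) := by field_simp; ring
      have h3 : (u / (1 - u)).re = ((1 + u) / (2 * (1 - u))).re - 1 / 2 := by
        rw [← h2]
        simp
      have h4 : 0 < ((1 + u) / (2 * (1 - u))).re := by
        have h5 : normSq u < 1 := by
          rw [normSq_eq_norm_sq]
          nlinarith [norm_nonneg u]
        have h6 : 0 < normSq (2 * (1 - u)) := normSq_pos.2 (mul_ne_zero two_ne_zero h1)
        rw [div_re, ← add_div]
        refine div_pos ?_ h6
        rw [normSq_apply] at h5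
        simp
        nlinarith
      linarith
  refine powerBounded_of_norm_inverse_one_sub_smul_le (M := M) (fun u hu => ?_) (fun u hu => ?_)
  · obtain ⟨hu1, h1, h2⟩ := hfac u hu
    rw [h1]
    exact (hM _ h2).1.smul (Units.mk0 _ (sub_ne_zero.2 hu1.symm))
  · obtain ⟨hu1, h1, h2⟩ := hfac u hu
    have h3 : 1 - u ≠ 0 := sub_ne_zero.2 hu1.symm
    have hU := (hM _ h2).1
    have hU' : IsUnit (1 - u • (1 + z • Q)) := by
      rw [h1]
      exact hU.smul (Units.mk0 _ h3)
    have hinv : Ring.inverse (1 - u • (1 + z • Q)) =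
        (1 - u)⁻¹ • Ring.inverse (1 - (u / (1 - u) * z) • Q) := by
      refine hU'.mul_left_cancel ?_
      rw [Ring.mul_inverse_cancel _ hU', h1, smul_mul_smul_comm, Ring.mul_inverse_cancel _ hU,
        mul_inv_cancel₀ h3, one_smul]
    rw [hinv, norm_smul, norm_inv, div_eq_inv_mul M]
    gcongr
    exact (hM _ h2).2

theorem interior_powerBoundedSet_subset_rittSet (hQ : IsQuasinilpotent Q) :
    interior (powerBoundedSet Q) ⊆ rittSet Q := by
  intro z hz
  rcases eq_or_ne z 0 with rfl | hz0
  · exact zero_mem_rittSet Q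
  rw [mem_rittSet_iff hQ hz0]
  have hz' : 0 < ‖z‖ := norm_pos_iff.2 hz0
  obtain ⟨ε, hε, hball⟩ := Metric.mem_nhds_iff.1 (mem_interior_iff_mem_nhds.1 hz)
  set d : ℝ := min 1 (ε / (2 * ‖z‖)) with hd
  have hd0 : 0 < d := by positivity
  -- Used for `c = ± d * I`: tilting `z` to either side changes the inner product `p` with `w` to `p
  -- ± d * s`, where `s` is the cross product. One sign gives `p + d * |s|`, which dominates `d *
  -- ‖z‖ * ‖w‖ / 2` when `p ≥ 0`.
  have hmem : ∀ c : ℂ, ‖c‖ = d → z + z * c ∈ powerBoundedSet Q := by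
    intro c hc
    refine hball ?_
    rw [mem_ball_iff_norm, add_sub_cancel_left, norm_mul, hc]
    calc ‖z‖ * d ≤ ‖z‖ * (ε / (2 * ‖z‖)) := by gcongr; exact min_le_right _ _
      _ = ε / 2 := by field_simp
      _ < ε := by linarith
  have hn : ‖(d : ℂ) * I‖ = d := by simp [abs_of_pos hd0]
  obtain ⟨N₁, h₁⟩ := hmem (d * I) hn
  obtain ⟨N₂, h₂⟩ := hmem (-(d * I)) (by rw [norm_neg, hn])
  have hu := isUnit_one_sub_smul_of_spectrum_eq hQ
  have hc : 0 < d * ‖z‖ / 2 := by positivity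
  refine ((resolventBoundedOn_of_powerBounded hu h₁ hc).union
    (resolventBoundedOn_of_powerBounded hu h₂ hc)).mono fun w hw => ?_
  have hw' : 0 ≤ inner ℝ z w := hw
  set p : ℝ := inner ℝ z w with hp
  set s : ℝ := z.re * w.im - z.im * w.re with hs
  have hp' : p = z.re * w.re + z.im * w.im := by
    rw [hp, Complex.inner]
    simp
    ring
  have hsum : p ^ 2 + s ^ 2 = (‖z‖ * ‖w‖) ^ 2 := by
    rw [mul_pow, ← normSq_eq_norm_sq, ← normSq_eq_norm_sq, normSq_apply, normSq_apply, hp', hs]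
    ring
  have e1 : inner ℝ (z + z * (d * I)) w = p + d * s := by
    rw [Complex.inner, hp', hs]
    simp
    ring
  have e2 : inner ℝ (z + z * (-(d * I))) w = p - d * s := by
    rw [Complex.inner, hp', hs]
    simp
    ring
  have hd1 : d ≤ 1 := min_le_left _ _
  have hzw : ‖z‖ * ‖w‖ ≤ p + |s| := by
    refine le_of_pow_le_pow_left₀ two_ne_zero (by positivity) ?_
    rw [← hsum, ← sq_abs s]
    nlinarith [mul_nonneg hw' (abs_nonneg s)]
  have key : d * ‖z‖ / 2 * ‖w‖ ≤ p + d * |s| := by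
    have : d * (‖z‖ * ‖w‖) ≤ d * (p + |s|) := by gcongr
    have : 0 ≤ ‖z‖ * ‖w‖ := by positivity
    nlinarith
  rcases le_total 0 s with h | h
  · left
    change d * ‖z‖ / 2 * ‖w‖ ≤ inner ℝ _ w
    rwa [e1, ← abs_of_nonneg h]
  · right
    change d * ‖z‖ / 2 * ‖w‖ ≤ inner ℝ _ w
    rw [e2]
    rw [abs_of_nonpos h] at key
    linarith

theorem zero_notMem_interior_powerBoundedSet (hQ : IsQuasinilpotent Q) (hQ0 : Q ≠ 0) :
    (0 : ℂ) ∉ interior (powerBoundedSet Q) := by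
  intro h
  obtain ⟨ε, hε, hball⟩ := Metric.mem_nhds_iff.1 (isOpen_interior.mem_nhds h)
  have hn : ‖((ε / 2 : ℝ) : ℂ)‖ = ε / 2 := by
    rw [norm_real, Real.norm_of_nonneg (by linarith)]
  have hz0 : ((ε / 2 : ℝ) : ℂ) ≠ 0 := by
    rw [← norm_pos_iff, hn]
    linarith
  have hmem : ∀ w : ℂ, ‖w‖ = ε / 2 → w ∈ rittSet Q := fun w hw =>
    interior_powerBoundedSet_subset_rittSet hQ (hball (by rw [mem_ball_zero_iff, hw]; linarith))
  exact neg_notMem_rittSet hQ hQ0 hz0 (hmem _ hn) (hmem _ (by rw [norm_neg, hn]))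

theorem isOpen_rittSet_sdiff_zero (hQ : IsQuasinilpotent Q) : IsOpen (rittSet Q \ {0}) := by
  rw [Metric.isOpen_iff]
  rintro z ⟨hz, hz0 : z ≠ 0⟩
  rw [mem_rittSet_iff hQ hz0] at hz
  obtain ⟨δ, hδ, h⟩ := hz.sector (isUnit_one_sub_smul_of_spectrum_eq hQ) hz0
  refine ⟨min δ ‖z‖, lt_min hδ (norm_pos_iff.2 hz0), fun y hy => ?_⟩
  rw [mem_ball_iff_norm, lt_min_iff] at hy
  have hy0 : y ≠ 0 := by
    rintro rfl
    simp at hy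
  refine ⟨(mem_rittSet_iff hQ hy0).2 (h.mono fun w hw => ?_), hy0⟩
  have h1 : inner ℝ z w = inner ℝ y w - inner ℝ (y - z) w := by rw [inner_sub_left]; ring
  have h2 := real_inner_le_norm (y - z) w
  have h3 : ‖y - z‖ * ‖w‖ ≤ δ * ‖w‖ := by gcongr; exact hy.1.le
  have h4 : 0 ≤ inner ℝ y w := hw
  change -(δ * ‖w‖) ≤ inner ℝ z w
  linarith

theorem isSector_rittSet_sdiff_zero (hQ : IsQuasinilpotent Q) (hQ0 : Q ≠ 0) :
    IsSector (rittSet Q \ {0}) := by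
  have hcone : ∀ z ∈ rittSet Q \ {0}, ∀ r : ℝ, 0 < r → r • z ∈ rittSet Q \ {0} := by
    rintro z ⟨hz, hz0 : z ≠ 0⟩ r hr
    have h1 : r • z ≠ 0 := smul_ne_zero hr.ne' hz0
    refine ⟨(mem_rittSet_iff hQ h1).2 (((mem_rittSet_iff hQ hz0).1 hz).mono fun w hw => ?_), h1⟩
    have h2 : 0 ≤ inner ℝ (r • z) w := hw
    rw [real_inner_smul_left] at h2
    exact nonneg_of_mul_nonneg_right h2 hr
  refine ⟨convex_iff_forall_pos.2 fun x hx y hy a b ha hb _ => ?_, fun z hz r hr => ?_⟩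
  · have hx' := hcone x hx a ha
    have hy' := hcone y hy b hb
    have h0 : a • x + b • y ≠ 0 := by
      intro h
      rw [add_eq_zero_iff_eq_neg'] at h
      exact neg_notMem_rittSet hQ hQ0 hx'.2 hx'.1 (h ▸ hy'.1)
    refine ⟨(mem_rittSet_iff hQ h0).2 ((((mem_rittSet_iff hQ hx'.2).1 hx'.1).union
      ((mem_rittSet_iff hQ hy'.2).1 hy'.1)).mono fun w hw => ?_), h0⟩
    have hw' : 0 ≤ inner ℝ (a • x + b • y) w := hw
    rw [inner_add_left] at hw'
    rcases le_total 0 (inner ℝ (a • x) w) with h | h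
    · exact Or.inl h
    · right
      change 0 ≤ inner ℝ (b • y) w
      linarith
  · rw [mul_comm, ← real_smul]
    exact hcone z hz r hr

theorem rittSet_eq_univ_iff (hQ : IsQuasinilpotent Q) : rittSet Q = Set.univ ↔ Q = 0 := by
  constructor
  · intro h
    by_contra hQ0
    exact neg_notMem_rittSet hQ hQ0 one_ne_zero (h ▸ Set.mem_univ 1) (h ▸ Set.mem_univ (-1))
  · rintro rfl
    exact rittSet_zero

theorem interior_powerBoundedSet_eq (hQ : IsQuasinilpotent Q) (hQ0 : Q ≠ 0) :
    interior (powerBoundedSet Q) = rittSet Q \ {0} := by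
  refine Set.Subset.antisymm (fun z hz => ⟨interior_powerBoundedSet_subset_rittSet hQ hz, ?_⟩)
    (interior_maximal (Set.sdiff_subset.trans (rittSet_subset_powerBoundedSet Q))
      (isOpen_rittSet_sdiff_zero hQ))
  rintro rfl
  exact zero_notMem_interior_powerBoundedSet hQ hQ0 hz

end RittSet

theorem theorem3p3 {X : Type*} [NormedAddCommGroup X] [NormedSpace ℂ X] [CompleteSpace X]
    (Q : X →L[ℂ] X) (hQ : IsQuasinilpotent Q) :
    (rittSet Q = interior (powerBoundedSet Q) ∪ {0} ∧
      (Q ≠ 0 → frontier (rittSet Q) = frontier (interior (powerBoundedSet Q)) ∪ {0})) ∧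
    (rittSet Q ≠ {0} ↔
      (interior (powerBoundedSet Q)).Nonempty ∧ IsOpen (interior (powerBoundedSet Q)) ∧
        IsSector (interior (powerBoundedSet Q))) ∧
    ((rittSet Q = {0} ∨ rittSet Q = Set.univ ∨
        ∃ φ ∈ Set.Ico (-Real.pi) Real.pi, ∃ θ ∈ Set.Ioc (0 : ℝ) (Real.pi / 2),
          rittSet Q = rotatedSector φ θ ∪ {0}) ∧
      (rittSet Q = Set.univ ↔ Q = 0)) := by
  -- For `Q = 0` the interior contains `0`, so its description as `rittSet Q \ {0}` fails and this
  -- case is separate.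
  rcases eq_or_ne Q 0 with rfl | hQ0
  · have hne : (Set.univ : Set ℂ) ≠ {0} := fun h => one_ne_zero (h ▸ Set.mem_univ (1 : ℂ) :)
    simp only [rittSet_zero, powerBoundedSet_zero, interior_univ]
    refine ⟨⟨by simp, fun h => absurd rfl h⟩, iff_of_true hne ⟨Set.univ_nonempty, isOpen_univ,
      convex_univ, fun _ _ _ _ => trivial⟩, Or.inr (Or.inl trivial), by simp⟩
  have hB := interior_powerBoundedSet_eq hQ hQ0
  have ho := isOpen_rittSet_sdiff_zero hQ
  have hS := isSector_rittSet_sdiff_zero hQ hQ0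
  have hR : rittSet Q = rittSet Q \ {0} ∪ {0} := by
    rw [Set.sdiff_union_self, Set.union_eq_self_of_subset_right]
    exact Set.singleton_subset_iff.2 (zero_mem_rittSet Q)
  have hopp : ∀ z ∈ rittSet Q \ {0}, -z ∉ rittSet Q \ {0} := fun z hz h =>
    neg_notMem_rittSet hQ hQ0 hz.2 hz.1 h.1
  have hne : rittSet Q ≠ {0} ↔ (rittSet Q \ {0}).Nonempty := by
    rw [Set.nonempty_iff_ne_empty, not_iff_not]
    constructor
    · intro h
      rw [h, sdiff_self, Set.bot_eq_empty]
    · intro h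
      rw [hR, h, Set.empty_union]
  rw [hB]
  refine ⟨⟨hR, fun _ => ?_⟩, ?_, ?_, rittSet_eq_univ_iff hQ⟩
  · conv_lhs => rw [hR]
    exact frontier_union_zero ho hopp
  · rw [hne]
    exact ⟨fun h => ⟨h, ho, hS⟩, fun h => h.1⟩
  · by_cases h : rittSet Q = {0}
    · exact Or.inl h
    · right
      right
      obtain ⟨φ, hφ, θ, hθ, h1⟩ := hS.exists_eq_rotatedSector ho (hne.1 h) hopp
      exact ⟨φ, hφ, θ, hθ, h1 ▸ hR⟩
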